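/- Let $(f_\alpha)_{\alpha\in\Delta}$ be a (finite or infinite) family of transcendental entire functions $f_\alpha:\mathbb C\to\mathbb C$ (entire functions that are not polynomials), and let $S=\langle f_\alpha\rangle$ be the transcendental semigroup generated by them, that is, the set of all compositions $f_{\alpha_1}\circ f_{\alpha_2}\circ\cdots\circ f_{\alpha_m}$ with $m\ge 1$ and $\alpha_1,\dots,\alpha_m\in\Delta$. Call $S$ normal on an open set $U\subset\mathbb C$ if every sequence in $S$ has a subsequence which either converges uniformly on compact subsets of $U$ to a function $U\to\mathbb C$, or diverges to $\infty$ uniformly on compact subsets of $U$. Let $F(S)$ be the set of all $z\in\mathbb C$ that have an open neighbourhood on which $S$ is normal (the Fatou set), and let $J(S)=\mathbb C\setminus F(S)$ (the Julia set). Suppose that $S$ is abelian, i.e. $f_\alpha\circ f_\beta=f_\beta\circ f_\alpha$ for all $\alpha,\beta\in\Delta$. Then the Fatou set is $S$-backward invariant and the Julia set is $S$-forward invariant: $$g^{-1}(F(S))\subset F(S)\quad\text{and}\quad g(J(S))\subset J(S)\qquad\text{for all } g\in S.$$ Moreover, both sets are $S$-completely invariant: for all $g\in S$ one also has $g(F(S))\subset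 F(S)$ and $g^{-1}(J(S))\subset J(S)$. -/

import Mathlib

namespace HolomorphicSemigroup

/-- A transcendental entire function: holomorphic on all of `ℂ` and not a polynomial function. -/
def IsTranscendentalEntire (f : ℂ → ℂ) : Prop :=
  Differentiable ℂ f ∧ ¬ ∃ p : Polynomial ℂ, ∀ z, f z = p.eval z

/-- The semigroup `⟨f_α⟩` of all compositions of finitely many (at least one) of the maps `f α`,
as a set of maps. Multiplication in `Function.End ℂ` is composition. No identity map is adjoined. -/
def generated {Δ : Type*} (f : Δ → ℂ → ℂ) : Set (ℂ → ℂ) :=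
  (Subsemigroup.closure (Set.range f : Set (Function.End ℂ)) : Set (Function.End ℂ))

/-- The semigroup generated by the maps `f α` is abelian: its generators commute pairwise. -/
def IsAbelian {Δ : Type*} (f : Δ → ℂ → ℂ) : Prop :=
  ∀ α β, f α ∘ f β = f β ∘ f α

/-- Uniform convergence to a finite limit on all compact subsets of `U`. -/
def ConvergesOnCompacts (g : ℕ → ℂ → ℂ) (U : Set ℂ) : Prop :=
  ∃ h : ℂ → ℂ, ∀ K ⊆ U, IsCompact K → TendstoUniformlyOn g h Filter.atTop K

/-- Uniform divergence to infinity on all compact subsets of `U`. -/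
def DivergesOnCompacts (g : ℕ → ℂ → ℂ) (U : Set ℂ) : Prop :=
  ∀ K ⊆ U, IsCompact K → ∀ M : ℝ, ∀ᶠ n in Filter.atTop, ∀ z ∈ K, M < ‖g n z‖

/-- A family of maps is normal on `U` if each sequence from it has a subsequence which, uniformly
on compact subsets of `U`, either converges or diverges to infinity. -/
def IsNormalOn (S : Set (ℂ → ℂ)) (U : Set ℂ) : Prop :=
  ∀ g : ℕ → ℂ → ℂ, (∀ n, g n ∈ S) → ∃ φ : ℕ → ℕ, StrictMono φ ∧
    (ConvergesOnCompacts (fun k => g (φ k)) U ∨ DivergesOnCompacts (fun k => g (φ k)) U)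

/-- The Fatou set: the points having an open neighbourhood on which `S` is normal. -/
def fatouSet (S : Set (ℂ → ℂ)) : Set ℂ :=
  {z | ∃ U : Set ℂ, IsOpen U ∧ z ∈ U ∧ IsNormalOn S U}

/-- The Julia set: the complement of the Fatou set. -/
def juliaSet (S : Set (ℂ → ℂ)) : Set ℂ :=
  (fatouSet S)ᶜ

def ForwardInvariant (S : Set (ℂ → ℂ)) (U : Set ℂ) : Prop :=
  ∀ f ∈ S, f '' U ⊆ U

def BackwardInvariant (S : Set (ℂ → ℂ)) (U : Set ℂ) : Prop :=
  ∀ f ∈ S, f ⁻¹' U ⊆ U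

def CompletelyInvariant (S : Set (ℂ → ℂ)) (U : Set ℂ) : Prop :=
  ForwardInvariant S U ∧ BackwardInvariant S U

end HolomorphicSemigroup

open Filter Metric Set Topology BoundedContinuousFunction

/-! Forward invariance of the Fatou set needs no commutativity: `S ∘ g ⊆ S`, and since `g` is open,
normality of the maps `f ∘ g` near `z` pushes forward to normality near `g z`. Backward invariance
rests on `f ∘ g = g ∘ f`. Let `f n` behave normally near `g z`. If `g ∘ f n = f n ∘ g` diverges near
`z`, so does `f n`, because `g` is bounded on discs. If it converges, `g ∘ f n` is eventually
bounded there, while `g` is unbounded by Liouville; so the `f n` omit a fixed disc about some `a`,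
and Montel and Hurwitz applied to `1 / (f n - a)` give normality. The Julia statements follow by
complements. -/

/-- **Montel's theorem** on a disc: a uniformly bounded sequence of holomorphic functions on a disc
has a subsequence which converges uniformly on a given smaller concentric disc. -/
theorem exists_subseq_tendstoUniformlyOn_closedBall {F : ℕ → ℂ → ℂ} {c : ℂ} {r R C : ℝ}
    (hrR : r < R) (hF : ∀ n, DifferentiableOn ℂ (F n) (ball c R))
    (hC : ∀ n, ∀ z ∈ ball c R, ‖F n z‖ ≤ C) :
    ∃ φ : ℕ → ℕ, StrictMono φ ∧
      ∃ h : ℂ → ℂ, TendstoUniformlyOn (fun k => F (φ k)) h atTop (closedBall c r) := by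
  have hsub : closedBall c r ⊆ ball c R := closedBall_subset_ball hrR
  have : CompactSpace (closedBall c r) :=
    isCompact_iff_compactSpace.mp (isCompact_closedBall c r)
  let G : ℕ → (closedBall c r →ᵇ ℂ) := fun n =>
    BoundedContinuousFunction.mkOfCompact
      ⟨fun x => F n x, ((hF n).continuousOn.mono hsub).domRestrict⟩
  -- The Schwarz lemma gives a Lipschitz bound independent of `n`, hence equicontinuity for
  -- Arzelà–Ascoli.
  have hlip : ∀ n, ∀ x ∈ closedBall c r, ∀ y ∈ ball x (R - r),
      dist (F n y) (F n x) ≤ (2 * C) / (R - r) * dist y x := by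
    intro n x hx y hy
    have hb : ball x (R - r) ⊆ ball c R := ball_subset_ball' (by
      have := mem_closedBall.mp hx
      linarith)
    refine Complex.dist_le_div_mul_dist_of_mapsTo_ball ((hF n).mono hb) ?_ hy
    intro w hw
    rw [mem_closedBall, dist_eq_norm]
    calc ‖F n w - F n x‖ ≤ ‖F n w‖ + ‖F n x‖ := norm_sub_le _ _
      _ ≤ C + C := add_le_add (hC n w (hb hw)) (hC n x (hsub hx))
      _ = 2 * C := by ring
  have hequi : Equicontinuous ((↑) : range G → closedBall c r → ℂ) := by
    intro x
    refine equicontinuousAt_of_continuity_modulus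
      (fun y => (2 * C) / (R - r) * dist y x) ?_ _ ?_
    · have : Continuous fun y : closedBall c r => (2 * C) / (R - r) * dist y x := by fun_prop
      simpa using this.tendsto x
    · filter_upwards [ball_mem_nhds x (sub_pos.mpr hrR)] with y hy
      rintro ⟨_, n, rfl⟩
      rw [dist_comm]
      exact hlip n x x.2 y hy
  have hcomp : IsCompact (closure (range G)) := by
    refine arzela_ascoli (closedBall 0 C) (isCompact_closedBall _ _) _ ?_ hequi
    rintro _ x ⟨n, rfl⟩
    exact mem_closedBall_zero_iff.mpr (hC n x (hsub x.2))
  obtain ⟨g, -, φ, hφ, hlim⟩ := hcomp.tendsto_subseq fun n => subset_closure (mem_range_self n)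
  refine ⟨φ, hφ, Function.extend Subtype.val g 0, ?_⟩
  rw [tendsto_iff_tendstoUniformly] at hlim
  rw [Metric.tendstoUniformlyOn_iff]
  intro ε hε
  filter_upwards [Metric.tendstoUniformly_iff.mp hlim ε hε] with k hk x hx
  have := Subtype.val_injective.extend_apply g 0 (⟨x, hx⟩ : closedBall c r)
  dsimp only at this
  rw [this]
  exact hk ⟨x, hx⟩

/-- **Hurwitz's theorem** for zero-free functions: a locally uniform limit of zero-free holomorphic
functions on a connected open set is either zero-free or identically zero. -/
theorem eqOn_zero_or_forall_ne_zero_of_tendstoLocallyUniformlyOn {F : ℕ → ℂ → ℂ} {h : ℂ → ℂ}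
    {U : Set ℂ} (hU : IsOpen U) (hUc : IsPreconnected U)
    (hF : ∀ n, DifferentiableOn ℂ (F n) U) (hF0 : ∀ n, ∀ z ∈ U, F n z ≠ 0)
    (hlim : TendstoLocallyUniformlyOn F h atTop U) :
    EqOn h 0 U ∨ ∀ z ∈ U, h z ≠ 0 := by
  have hh : DifferentiableOn ℂ h U := hlim.differentiableOn (Eventually.of_forall hF) hU
  rw [or_iff_not_imp_left]
  intro hne z hz hz0
  have hev : ∀ᶠ w in 𝓝[≠] z, h w ≠ 0 := by
    by_contra hfr
    exact hne ((hh.analyticOnNhd hU).eqOn_zero_of_preconnected_of_frequently_eq_zero hUc hz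
      (not_eventually.mp hfr |>.mono fun _ => not_not.mp))
  obtain ⟨ρ, hρ, hball⟩ := Metric.eventually_nhds_iff_ball.mp
    ((eventually_nhdsWithin_iff.mp hev).and (hU.mem_nhds hz))
  have hsub : closedBall z (ρ / 2) ⊆ U := fun w hw =>
    (hball w (closedBall_subset_ball (by linarith) hw)).2
  have hsph : sphere z (ρ / 2) ⊆ U := sphere_subset_closedBall.trans hsub
  have hsph0 : ∀ w ∈ sphere z (ρ / 2), h w ≠ 0 := fun w hw =>
    (hball w (closedBall_subset_ball (by linarith) (sphere_subset_closedBall hw))).1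
      (ne_of_mem_sphere hw (by linarith))
  obtain ⟨w₀, hw₀, hmin⟩ := (isCompact_sphere z (ρ / 2)).exists_isMinOn
    (NormedSpace.sphere_nonempty.mpr (by linarith)) (hh.continuousOn.mono hsph).norm
  set δ := ‖h w₀‖ with hδ
  have hδ0 : 0 < δ := norm_pos_iff.mpr (hsph0 w₀ hw₀)
  have hunif := (tendstoLocallyUniformlyOn_iff_forall_isCompact hU).mp hlim _ hsub
    (isCompact_closedBall _ _)
  obtain ⟨n, hn⟩ := (Metric.tendstoUniformlyOn_iff.mp hunif (δ / 2) (by linarith)).exists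
  -- On the circle `‖F n‖ ≥ δ / 2`, so the maximum principle for `1 / F n` gives `‖F n z‖ ≥ δ / 2`,
  -- against `F n z` being within `δ / 2` of `h z = 0`.
  have hbd : ∀ w ∈ frontier (ball z (ρ / 2)), ‖(F n)⁻¹ w‖ ≤ (δ / 2)⁻¹ := by
    intro w hw
    rw [frontier_ball z (by linarith : ρ / 2 ≠ 0)] at hw
    have h1 := hn w (sphere_subset_closedBall hw)
    have h2 : δ ≤ ‖h w‖ := hmin hw
    rw [dist_eq_norm] at h1
    have h3 := norm_sub_norm_le (h w) (F n w)
    rw [Pi.inv_apply, norm_inv]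
    exact inv_anti₀ (by linarith) (by linarith)
  have hdiff : DiffContOnCl ℂ (F n)⁻¹ (ball z (ρ / 2)) :=
    (((hF n).inv (hF0 n)).mono (closure_ball_subset_closedBall.trans hsub)).diffContOnCl
  have hcen := Complex.norm_le_of_forall_mem_frontier_norm_le isBounded_ball hdiff hbd
    (subset_closure (mem_ball_self (by linarith)))
  have hzU := hn z (mem_closedBall_self (by linarith))
  rw [hz0, dist_eq_norm, zero_sub, norm_neg] at hzU
  rw [Pi.inv_apply, norm_inv] at hcen
  exact absurd hzU
    (not_lt.mpr ((inv_le_inv₀ (norm_pos_iff.mpr (hF0 n z hz)) (by linarith)).mp hcen))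

namespace HolomorphicSemigroup

/-- Holomorphic functions on a disc which omit a fixed disc of values form a normal family on each
smaller concentric disc. -/
theorem exists_subseq_of_omits_ball {F : ℕ → ℂ → ℂ} {c a : ℂ} {r R ε : ℝ} (hrR : r < R)
    (hε : 0 < ε) (hF : ∀ n, DifferentiableOn ℂ (F n) (ball c R))
    (ha : ∀ n, ∀ z ∈ ball c R, ε ≤ ‖F n z - a‖) :
    ∃ φ : ℕ → ℕ, StrictMono φ ∧ (ConvergesOnCompacts (fun k => F (φ k)) (ball c r) ∨
      DivergesOnCompacts (fun k => F (φ k)) (ball c r)) := by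
  have hne : ∀ n, ∀ z ∈ ball c R, F n z - a ≠ 0 := fun n z hz =>
    norm_pos_iff.mp (hε.trans_le (ha n z hz))
  have hQ : ∀ n, DifferentiableOn ℂ (fun z => (F n z - a)⁻¹) (ball c R) := fun n =>
    ((hF n).sub_const a).inv (hne n)
  obtain ⟨φ, hφ, h, hlim⟩ := exists_subseq_tendstoUniformlyOn_closedBall (C := ε⁻¹) hrR hQ
    (fun n z hz => by
      rw [norm_inv]
      exact inv_anti₀ hε (ha n z hz))
  have hsub : ball c r ⊆ ball c R := ball_subset_ball hrR.le
  have hloc := (hlim.mono ball_subset_closedBall).tendstoLocallyUniformlyOn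
  have hcont := (hloc.differentiableOn
    (Eventually.of_forall fun k => (hQ (φ k)).mono hsub) isOpen_ball).continuousOn
  refine ⟨φ, hφ, ?_⟩
  rcases eqOn_zero_or_forall_ne_zero_of_tendstoLocallyUniformlyOn isOpen_ball
    (convex_ball c r).isPreconnected (fun k => (hQ (φ k)).mono hsub)
    (fun k z hz => inv_ne_zero (hne _ z (hsub hz))) hloc with h0 | h0
  · right
    intro K hK _ M
    have hM : 0 < |M| + ‖a‖ + 1 := by positivity
    filter_upwards [Metric.tendstoUniformlyOn_iff.mp hlim _ (inv_pos.mpr hM)] with k hk z hz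
    have h1 := hk z (ball_subset_closedBall (hK hz))
    rw [h0 (hK hz), Pi.zero_apply, dist_zero_left, norm_inv] at h1
    have h2 := (inv_lt_inv₀ (norm_pos_iff.mpr (hne _ z (hsub (hK hz)))) hM).mp h1
    have h3 := norm_sub_le (F (φ k) z) a
    have h4 := le_abs_self M
    linarith
  · left
    refine ⟨fun z => (h z)⁻¹ + a, fun K hK hKc => ?_⟩
    have hinv := (tendstoLocallyUniformlyOn_iff_forall_isCompact isOpen_ball).mp
      (hloc.inv₀ hcont h0) K hK hKc
    rw [Metric.tendstoUniformlyOn_iff] at hinv ⊢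
    intro η hη
    filter_upwards [hinv η hη] with k hk z hz
    have := hk z hz
    simp only [Pi.inv_apply, inv_inv] at this
    rwa [← dist_add_right _ _ a, sub_add_cancel] at this

/-- The Fatou set is forward invariant under open maps `g` with `S ∘ g ⊆ S`. -/
theorem image_fatouSet_subset {S : Set (ℂ → ℂ)} {g : ℂ → ℂ} (hg : IsOpenMap g)
    (hS : ∀ f ∈ S, f ∘ g ∈ S) : g '' fatouSet S ⊆ fatouSet S := by
  rintro _ ⟨z, ⟨U, hU, hzU, hN⟩, rfl⟩
  obtain ⟨r, hr, hrU⟩ := Metric.nhds_basis_closedBall.mem_iff.mp (hU.mem_nhds hzU)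
  refine ⟨g '' ball z r, hg _ isOpen_ball, mem_image_of_mem g (mem_ball_self hr), ?_⟩
  intro f hf
  have hD := isCompact_closedBall z r
  have hpre : ∀ K ⊆ g '' ball z r, ∀ y ∈ K, ∃ x ∈ closedBall z r, g x = y := fun K hK y hy =>
    image_mono ball_subset_closedBall (hK hy)
  obtain ⟨φ, hφ, ⟨h, hlim⟩ | hdiv⟩ := hN (fun n => f n ∘ g) fun n => hS _ (hf n)
  · have hlim' := Metric.tendstoUniformlyOn_iff.mp (hlim _ hrU hD)
    -- A set-theoretic section of `g` suffices: the limit `h ∘ s` need not be shown continuous.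
    choose! s hs hgs using hpre _ subset_rfl
    refine ⟨φ, hφ, Or.inl ⟨fun y => h (s y), fun K hK _ => ?_⟩⟩
    rw [Metric.tendstoUniformlyOn_iff]
    intro ε hε
    filter_upwards [hlim' ε hε] with k hk y hy
    have := hk _ (hs y (hK hy))
    rwa [Function.comp_apply, hgs y (hK hy)] at this
  · refine ⟨φ, hφ, Or.inr fun K hK _ M => ?_⟩
    filter_upwards [hdiv _ hrU hD M] with k hk y hy
    obtain ⟨x, hx, rfl⟩ := hpre K hK y hy
    exact hk x hx

/-- The Fatou set of a family of entire functions is backward invariant under every unbounded entire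
function which commutes with the family. -/
theorem preimage_fatouSet_subset {S : Set (ℂ → ℂ)} {g : ℂ → ℂ}
    (hS : ∀ f ∈ S, Differentiable ℂ f) (hg : Continuous g) (hub : ∀ B : ℝ, ∃ a, B < ‖g a‖)
    (hcomm : ∀ f ∈ S, f ∘ g = g ∘ f) : g ⁻¹' fatouSet S ⊆ fatouSet S := by
  rintro z ⟨V, hV, hzV, hN⟩
  obtain ⟨R, hR, hRV⟩ := Metric.nhds_basis_closedBall.mem_iff.mp
    ((hV.preimage hg).mem_nhds hzV)
  refine ⟨ball z (R / 2), isOpen_ball, mem_ball_self (by linarith), ?_⟩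
  intro f hf
  have hD : IsCompact (g '' closedBall z R) := (isCompact_closedBall z R).image hg
  have hDV : g '' closedBall z R ⊆ V := image_subset_iff.mpr hRV
  have hcomm' : ∀ n x, f n (g x) = g (f n x) := fun n x => congrFun (hcomm _ (hf n)) x
  obtain ⟨φ, hφ, ⟨h, hlim⟩ | hdiv⟩ := hN f hf
  -- Nothing is known about the size of `h`, so later terms are compared with `f (φ N)`, bounded by
  -- `B`; passing through `h` costs `1 + 1`.
  · obtain ⟨N, hN⟩ := eventually_atTop.mp
      (Metric.tendstoUniformlyOn_iff.mp (hlim _ hDV hD) 1 one_pos)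
    obtain ⟨B, hB⟩ := hD.exists_bound_of_continuousOn (hS _ (hf (φ N))).continuous.continuousOn
    have hbound : ∀ k, ∀ x ∈ ball z R, ‖g (f (φ (k + N)) x)‖ ≤ B + 2 := by
      intro k x hx
      have hy : g x ∈ g '' closedBall z R := mem_image_of_mem g (ball_subset_closedBall hx)
      have h1 := hN (k + N) (Nat.le_add_left _ _) _ hy
      have h2 := hN N le_rfl _ hy
      have h3 := hB _ hy
      have h4 := dist_triangle_left (f (φ (k + N)) (g x)) (f (φ N) (g x)) (h (g x))
      have h5 := norm_sub_norm_le (f (φ (k + N)) (g x)) (f (φ N) (g x))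
      rw [← dist_eq_norm] at h5
      rw [← hcomm']
      linarith
    obtain ⟨a, ha⟩ := hub (B + 2)
    obtain ⟨ε, hε, hball⟩ := Metric.isOpen_iff.mp (isOpen_lt continuous_const hg.norm) a ha
    obtain ⟨ψ, hψ, h⟩ := exists_subseq_of_omits_ball (F := fun k => f (φ (k + N))) (a := a)
      (half_lt_self hR) hε (fun k => (hS _ (hf _)).differentiableOn) (fun k x hx => by
        by_contra! hlt
        rw [← dist_eq_norm] at hlt
        exact (hbound k x hx).not_gt (hball hlt))
    exact ⟨fun k => φ (ψ k + N), fun i j hij => hφ (Nat.add_lt_add_right (hψ hij) N), h⟩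
  · refine ⟨φ, hφ, Or.inr fun K hK _ M => ?_⟩
    -- As `‖g‖ ≤ C` on the disc of radius `M`, `‖g (f n x)‖ > C` forces `‖f n x‖ > M`.
    obtain ⟨C, hC⟩ := (isCompact_closedBall (0 : ℂ) M).exists_bound_of_continuousOn
      hg.continuousOn
    filter_upwards [hdiv _ hDV hD C] with k hk x hx
    have hxR : x ∈ closedBall z R :=
      ball_subset_closedBall (ball_subset_ball (half_le_self hR.le) (hK hx))
    have h1 := hk _ (mem_image_of_mem g hxR)
    rw [hcomm'] at h1
    by_contra! hle
    exact (hC _ (mem_closedBall_zero_iff.mpr hle)).not_gt h1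

/-- By Liouville a bounded entire map is constant, hence not open. Openness replaces transcendence
here because it passes to compositions at once. -/
theorem exists_lt_norm_of_isOpenMap {g : ℂ → ℂ} (hg : Differentiable ℂ g) (ho : IsOpenMap g)
    (B : ℝ) : ∃ a, B < ‖g a‖ := by
  by_contra! hB
  have hconst : ∀ z w, g z = g w := hg.apply_eq_apply_of_bounded
    (isBounded_iff_forall_norm_le.mpr ⟨B, by rintro _ ⟨x, rfl⟩; exact hB x⟩)
  have hopen : IsOpen ({g 0} : Set ℂ) := by
    have hr : range g = {g 0} := by
      ext y
      exact ⟨by rintro ⟨x, rfl⟩; exact hconst x 0, by rintro rfl; exact mem_range_self 0⟩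
    exact hr ▸ ho.isOpen_range
  exact not_isOpen_singleton (g 0) hopen

theorem IsTranscendentalEntire.isOpenMap {f : ℂ → ℂ} (hf : IsTranscendentalEntire f) :
    IsOpenMap f := by
  rcases (hf.1.differentiableOn.analyticOnNhd isOpen_univ).is_constant_or_isOpenMap with
    ⟨w, hw⟩ | h
  · exact absurd ⟨Polynomial.C w, fun z => by simp [hw z]⟩ hf.2
  · exact h

theorem comp_mem_generated {Δ : Type*} {f : Δ → ℂ → ℂ} {g h : ℂ → ℂ} (hg : g ∈ generated f)
    (hh : h ∈ generated f) : g ∘ h ∈ generated f :=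
  (Subsemigroup.closure (range f : Set (Function.End ℂ))).mul_mem hg hh

theorem generated_induction {Δ : Type*} {f : Δ → ℂ → ℂ} {p : (ℂ → ℂ) → Prop}
    (hgen : ∀ α, p (f α)) (hcomp : ∀ g h, p g → p h → p (g ∘ h)) {g : ℂ → ℂ}
    (hg : g ∈ generated f) : p g :=
  Subsemigroup.closure_induction (M := Function.End ℂ) (p := fun x _ => p x)
    (by rintro _ ⟨α, rfl⟩; exact hgen α) (fun x y _ _ hx hy => hcomp x y hx hy) hg

theorem IsAbelian.comp_comm {Δ : Type*} {f : Δ → ℂ → ℂ} (hab : IsAbelian f) {g h : ℂ → ℂ}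
    (hg : g ∈ generated f) (hh : h ∈ generated f) : g ∘ h = h ∘ g := by
  refine generated_induction (p := fun g => g ∘ h = h ∘ g) (fun α => ?_) (fun u v hu hv => ?_) hg
  · refine generated_induction (p := fun h => f α ∘ h = h ∘ f α) (fun β => hab α β)
      (fun u v hu hv => ?_) hh
    rw [← Function.comp_assoc, hu, Function.comp_assoc, hv, Function.comp_assoc]
  · rw [Function.comp_assoc, hv, ← Function.comp_assoc, hu, Function.comp_assoc]

end HolomorphicSemigroup

theorem theorem2p9 {Δ : Type*} (f : Δ → ℂ → ℂ)
    (hf : ∀ α, HolomorphicSemigroup.IsTranscendentalEntire (f α))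
    (hab : HolomorphicSemigroup.IsAbelian f) (S : Set (ℂ → ℂ))
    (hS : S = HolomorphicSemigroup.generated f) :
    HolomorphicSemigroup.BackwardInvariant S (HolomorphicSemigroup.fatouSet S) ∧
    HolomorphicSemigroup.ForwardInvariant S (HolomorphicSemigroup.juliaSet S) ∧
    HolomorphicSemigroup.CompletelyInvariant S (HolomorphicSemigroup.fatouSet S) ∧
    HolomorphicSemigroup.CompletelyInvariant S (HolomorphicSemigroup.juliaSet S) := by
  subst hS
  have hprop : ∀ g ∈ HolomorphicSemigroup.generated f, Differentiable ℂ g ∧ IsOpenMap g :=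
    fun g hg => HolomorphicSemigroup.generated_induction
      (p := fun g => Differentiable ℂ g ∧ IsOpenMap g)
      (fun α => ⟨(hf α).1, (hf α).isOpenMap⟩)
      (fun u v hu hv => ⟨hu.1.comp hv.1, hu.2.comp hv.2⟩) hg
  have hfwd : HolomorphicSemigroup.ForwardInvariant (HolomorphicSemigroup.generated f)
      (HolomorphicSemigroup.fatouSet (HolomorphicSemigroup.generated f)) := fun g hg =>
    HolomorphicSemigroup.image_fatouSet_subset (hprop g hg).2
      fun u hu => HolomorphicSemigroup.comp_mem_generated hu hg
  have hbwd : HolomorphicSemigroup.BackwardInvariant (HolomorphicSemigroup.generated f)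
      (HolomorphicSemigroup.fatouSet (HolomorphicSemigroup.generated f)) := fun g hg =>
    HolomorphicSemigroup.preimage_fatouSet_subset (fun u hu => (hprop u hu).1)
      (hprop g hg).1.continuous
      (HolomorphicSemigroup.exists_lt_norm_of_isOpenMap (hprop g hg).1 (hprop g hg).2)
      fun u hu => hab.comp_comm hu hg
  have hJ : HolomorphicSemigroup.ForwardInvariant (HolomorphicSemigroup.generated f)
      (HolomorphicSemigroup.juliaSet (HolomorphicSemigroup.generated f)) := by
    rintro g hg _ ⟨z, hz, rfl⟩ hgz
    exact hz (hbwd g hg hgz)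
  exact ⟨hbwd, hJ, ⟨hfwd, hbwd⟩, hJ, fun g hg z hz hzF => hz (hfwd g hg ⟨z, hzF, rfl⟩)⟩
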